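/- Let $n\in\mathbb N$ and let $\Omega\subset\mathbb R^n$ be an arbitrary set. Let $\mathcal B(\Omega)$ be the Borel $\sigma$-algebra of $\Omega$ (generated by the relatively open sets) and $\lambda$ the Lebesgue measure on $\mathcal B(\Omega)$ (if $\Omega$ is not Lebesgue measurable, $\lambda(B)$ is the Lebesgue outer measure of $B$, which is a measure on $\mathcal B(\Omega)$). Let $\mathrm{ba}(\Omega,\mathcal B(\Omega),\lambda)$ be the real vector space of all bounded finitely additive $\nu:\mathcal B(\Omega)\to\mathbb R$ that are weakly absolutely continuous with respect to $\lambda$, i.e. $\lambda(A)=0$ implies $\nu(A)=0$. For such $\nu$ let $|\nu|(A)=\sup\sum_{i}|\nu(A_i)|$, the supremum over all finite partitions of $A\in\mathcal B(\Omega)$ into sets $A_i\in\mathcal B(\Omega)$, and $|\nu|^*(S)=\inf\{|\nu|(A): A\in\mathcal B(\Omega),\ S\subset A\}$ for $S\subset\Omega$. A function $f:\Omega\to\mathbb R$ is called $\nu$-integrable with integral $\int_\Omega f\,d\nu=\lim_{k}\int_\Omega h_k\,d\nu$ if there are Borel simple functions $h_k$ with $|\nu|^*(\{|h_k-f|>\varepsilon\})\to0$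 as $k\to\infty$ for every $\varepsilon>0$ and $\int_\Omega|h_k-h_l|\,d|\nu|\to0$ as $k,l\to\infty$. Equip $L^\infty(\Omega)^n=L^\infty(\Omega,\mathcal B(\Omega),\lambda;\mathbb R)^n$ with the norm $\|F\|=\max_{1\le k\le n}\|F_k\|_\infty$. Then its dual is $\mathrm{ba}(\Omega,\mathcal B(\Omega),\lambda)^n$ with the norm $\|\nu\|=\sum_{k=1}^n|\nu_k|(\Omega)$, in the following sense. For all $\nu\in \mathrm{ba}(\Omega,\mathcal B(\Omega),\lambda)^n$ and $F\in L^\infty(\Omega)^n$ each $F_k$ is $\nu_k$-integrable, and $$\Phi_\nu(F)=\sum_{k=1}^n\int_\Omega F_k\,d\nu_k$$ defines a linear bijection $\nu\mapsto\Phi_\nu$ of $\mathrm{ba}(\Omega,\mathcal B(\Omega),\lambda)^n$ onto the space of continuous linear functionals on $L^\infty(\Omega)^n$ such that $$\|\Phi_\nu\|=\sum_{k=1}^n|\nu_k|(\Omega)\qquad\text{for every }\nu .$$ -/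

import Mathlib

open MeasureTheory Filter Topology
open scoped ENNReal

namespace FinAdd

noncomputable section

/-- The Lebesgue measure `λ` on the Borel subsets of an arbitrary set `Ω ⊆ ℝⁿ`: a relatively Borel
set `B ⊆ Ω` receives the Lebesgue outer measure of `B` as a subset of `ℝⁿ` (see `lebesgueOn_apply`).
This is Lebesgue measure of `B` when `Ω` is measurable. -/
def lebesgueOn {n : ℕ} (Ω : Set (EuclideanSpace ℝ (Fin n))) : Measure Ω :=
  (OuterMeasure.comap (Subtype.val : Ω → EuclideanSpace ℝ (Fin n))
    (volume : Measure (EuclideanSpace ℝ (Fin n))).toOuterMeasure).toMeasure (by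
      rintro s ⟨t, ht, rfl⟩
      refine (OuterMeasure.isCaratheodory_iff _).2 fun u => ?_
      have h := measure_inter_add_sdiff (μ := (volume : Measure (EuclideanSpace ℝ (Fin n))))
        (Subtype.val '' u) ht
      simp only [OuterMeasure.comap_apply, Measure.coe_toOuterMeasure]
      rw [← h, Set.image_inter_preimage, ← Set.image_sdiff_preimage])

theorem lebesgueOn_apply {n : ℕ} (Ω : Set (EuclideanSpace ℝ (Fin n))) {B : Set Ω}
    (hB : MeasurableSet B) :
    lebesgueOn Ω B =
      (volume : Measure (EuclideanSpace ℝ (Fin n))) (Subtype.val '' B) := by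
  rw [lebesgueOn, toMeasure_apply _ _ hB]
  simp

variable {X : Type*} [MeasurableSpace X]

/-- The σ-algebra of `X`, as a Boolean algebra of sets. -/
abbrev MSet (X : Type*) [MeasurableSpace X] : Type _ := {s : Set X // MeasurableSet s}

/-- The vector space of bounded finitely additive real measures on the σ-algebra of `X` that are
weakly absolutely continuous with respect to `μ`: they vanish on every `μ`-null set. -/
def ba (μ : Measure X) : Submodule ℝ (MSet X → ℝ) where
  carrier := {ν |
    (∀ A B : MSet X, Disjoint A B → ν (A ⊔ B) = ν A + ν B) ∧
    (∃ C : ℝ, ∀ A : MSet X, |ν A| ≤ C) ∧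
    (∀ A : MSet X, μ (A : Set X) = 0 → ν A = 0)}
  zero_mem' := ⟨fun _ _ _ => by simp, ⟨0, fun _ => by simp⟩, fun _ _ => rfl⟩
  add_mem' := by
    rintro ν ν' ⟨h1, ⟨C, hC⟩, h3⟩ ⟨h1', ⟨C', hC'⟩, h3'⟩
    refine ⟨fun A B hAB => ?_, ⟨C + C', fun A => ?_⟩, fun A hA => ?_⟩
    · simp only [Pi.add_apply, h1 A B hAB, h1' A B hAB]; ring
    · exact (abs_add_le _ _).trans (add_le_add (hC A) (hC' A))
    · simp [h3 A hA, h3' A hA]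
  smul_mem' := by
    rintro c ν ⟨h1, ⟨C, hC⟩, h3⟩
    refine ⟨fun A B hAB => ?_, ⟨|c| * C, fun A => ?_⟩, fun A hA => ?_⟩
    · simp only [Pi.smul_apply, smul_eq_mul, h1 A B hAB]; ring
    · simp only [Pi.smul_apply, smul_eq_mul, abs_mul]
      exact mul_le_mul_of_nonneg_left (hC A) (abs_nonneg c)
    · simp [h3 A hA]

/-- The total variation `|ν|(A)`: the supremum of `∑ |ν(B)|` over all finite partitions of `A`
into measurable sets `B`. -/
def totalVar (ν : MSet X → ℝ) (A : MSet X) : ℝ :=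
  ⨆ P : Finpartition A, ∑ B ∈ P.parts, |ν B|

/-- The supremum that defines the total variation is finite for every measure in `ba μ`. -/
theorem bddAbove_totalVar {μ : Measure X} {ν : MSet X → ℝ} (hν : ν ∈ ba μ) (A : MSet X) :
    BddAbove (Set.range fun P : Finpartition A => ∑ B ∈ P.parts, |ν B|) := by
  classical
  obtain ⟨hadd, ⟨C, hC⟩, -⟩ := hν
  have h0 : ν ⊥ = 0 := by
    have := hadd ⊥ ⊥ disjoint_bot_left
    simp only [sup_idem] at this
    linarith
  have hsum : ∀ (T : Finset (MSet X)), T.SupIndep id → ∑ B ∈ T, ν B = ν (T.sup id) := by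
    intro T
    induction T using Finset.induction_on with
    | empty => intro _; simp [h0]
    | insert a T ha ih =>
      intro hT
      rw [Finset.sum_insert ha, ih (hT.subset (Finset.subset_insert a T)), Finset.sup_insert,
        hadd]
      · rfl
      · exact hT (Finset.subset_insert a T) (Finset.mem_insert_self a T) ha
  refine ⟨C + C, ?_⟩
  rintro _ ⟨P, rfl⟩
  have hsplit := Finset.sum_filter_add_sum_filter_not P.parts (fun B => 0 ≤ ν B) (fun B => |ν B|)
  have hp : ∑ B ∈ P.parts.filter (fun B => 0 ≤ ν B), |ν B| ≤ C := by
    rw [Finset.sum_congr rfl fun B hB => abs_of_nonneg (Finset.mem_filter.1 hB).2,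
      hsum _ (P.supIndep.subset (Finset.filter_subset _ _))]
    exact (le_abs_self _).trans (hC _)
  have hn : ∑ B ∈ P.parts.filter (fun B => ¬ 0 ≤ ν B), |ν B| ≤ C := by
    rw [Finset.sum_congr rfl fun B hB => abs_of_neg (not_le.1 (Finset.mem_filter.1 hB).2),
      Finset.sum_neg_distrib, hsum _ (P.supIndep.subset (Finset.filter_subset _ _))]
    exact (neg_le_abs _).trans (hC _)
  simp only
  rw [← hsplit]
  exact add_le_add hp hn

/-- The outer measure `|ν|*(S)`: the infimum of `|ν|(A)` over the measurable sets `A ⊇ S`. -/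
def outerVar (ν : MSet X → ℝ) (S : Set X) : ℝ :=
  ⨅ A : {A : MSet X // S ⊆ (A : Set X)}, totalVar ν A.1

/-- Convergence in measure, with respect to `ν`, of a sequence of functions. -/
def ConvInMeasure (ν : MSet X → ℝ) (f : ℕ → X → ℝ) (g : X → ℝ) : Prop :=
  ∀ ε : ℝ, 0 < ε → Tendsto (fun k => outerVar ν {x | ε < |f k x - g x|}) atTop (𝓝 0)

/-- The integral `∑ y, y * ν {s = y}` of a simple function. -/
def simpleIntegral (ν : MSet X → ℝ) (s : SimpleFunc X ℝ) : ℝ :=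
  ∑ y ∈ s.range, y * ν ⟨s ⁻¹' {y}, s.measurableSet_fiber y⟩

/-- `s` is a determining sequence for the integral of `f`: the simple functions `s k` converge to
`f` in measure, and `∫ |s k - s l| d|ν| → 0` as `k, l → ∞`. -/
def IsDeterminingSeq (ν : MSet X → ℝ) (s : ℕ → SimpleFunc X ℝ) (f : X → ℝ) : Prop :=
  ConvInMeasure ν (fun k => s k) f ∧
  Tendsto (fun p : ℕ × ℕ => simpleIntegral (totalVar ν) ((s p.1 - s p.2).map fun y => |y|))
    atTop (𝓝 0)

/-- `I` is the limit of the integrals along some determining sequence for `f`. -/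
def HasIntegral (ν : MSet X → ℝ) (f : X → ℝ) (I : ℝ) : Prop :=
  ∃ s : ℕ → SimpleFunc X ℝ, IsDeterminingSeq ν s f ∧
    Tendsto (fun k => simpleIntegral ν (s k)) atTop (𝓝 I)

/-- Integrability with respect to a finitely additive measure. -/
def FAIntegrable (ν : MSet X → ℝ) (f : X → ℝ) : Prop :=
  ∃ I : ℝ, HasIntegral ν f I

open Classical in
/-- The integral `∫ f dν` with respect to a finitely additive measure (`0` if `f` is not
integrable). -/
def faIntegral (ν : MSet X → ℝ) (f : X → ℝ) : ℝ :=
  if h : FAIntegrable ν f then h.choose else 0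

end

end FinAdd

/-! Nothing about Lebesgue measure is used: the argument works for any measure `μ`, so the nature of
`Ω` plays no role. A functional `φ` on `L^∞` is determined by the set function `A ↦ φ 1_A`, because
simple functions are dense in the essential sup norm. This set function is finitely additive,
bounded by `‖φ‖`, and blind to null sets. Conversely, `|∫ s dν| ≤ sup |s| · |ν|(X)` extends the
integral from simple functions to all of `L^∞`. The link with the abstract integral is
`HasIntegral.abs_sub_simpleIntegral_le`: along any determining sequence, the limit stays within `ε
|ν|(X)` of `∫ s dν` whenever `|f - s| ≤ ε` almost everywhere. All properties of the integral follow
by simple approximation. For the norm, `|ν|(A)` is the supremum of `ν B - ν (A \ B)` over `B ≤ A`,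
so the functions `1_B - 1_{X \ B}` nearly attain `|ν|(X)`. On a finite power with the max norm,
coordinates can be optimized independently and the norms add. -/

namespace FinAdd

noncomputable section

variable {X : Type*} [MeasurableSpace X]
-- Total variation as a finitely additive measure
section TotalVariation

variable {μ : Measure X} {ν : MSet X → ℝ}

theorem ba_bot (hν : ν ∈ ba μ) : ν ⊥ = 0 := by
  have := hν.1 ⊥ ⊥ disjoint_bot_left
  simp only [sup_idem] at this
  linarith

theorem ba_sum_eq (hν : ν ∈ ba μ) (T : Finset (MSet X)) (hT : T.SupIndep id) :
    ∑ B ∈ T, ν B = ν (T.sup id) := by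
  classical
  induction T using Finset.induction_on with
  | empty => simp [ba_bot hν]
  | insert a T ha ih =>
    rw [Finset.sum_insert ha, ih (hT.subset (Finset.subset_insert a T)), Finset.sup_insert, hν.1]
    · rfl
    · exact hT (Finset.subset_insert a T) (Finset.mem_insert_self a T) ha

/-- With `totalVar_le`, this replaces the supremum over all partitions by one over two-set
splittings. -/
theorem sub_sdiff_le_totalVar (hν : ν ∈ ba μ) {A B : MSet X} (hB : B ≤ A) :
    ν B - ν (A \ B) ≤ totalVar ν A := by
  classical
  have hdis : Disjoint B (A \ B) := disjoint_sdiff_self_right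
  have hind : ({B, A \ B} : Finset (MSet X)).SupIndep id := by
    by_cases h : B = A \ B
    · rw [← h]; simp
    · exact (Finset.supIndep_pair h).2 hdis
  -- A `Finpartition` has no empty part, so `⊥` is erased; this costs nothing since `ν ⊥ = 0`.
  let P : Finpartition A := Finpartition.ofErase {B, A \ B} hind (by simp [hB])
  refine le_trans ?_ (le_ciSup (bddAbove_totalVar hν A) P)
  have hP : ∑ C ∈ P.parts, |ν C| = ∑ C ∈ ({B, A \ B} : Finset (MSet X)), |ν C| := by
    refine Finset.sum_erase _ ?_
    simp [ba_bot hν]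
  rw [hP]
  by_cases h : B = A \ B
  · rw [← h]; simp
  · rw [Finset.sum_pair h]
    exact (sub_le_iff_le_add.2 (by linarith [le_abs_self (ν B), neg_abs_le (ν (A \ B))]))

/-- Merging the parts with `ν ≥ 0` into one set, and the others into a second, leaves the sum of
absolute values unchanged. -/
theorem totalVar_le (hν : ν ∈ ba μ) {A : MSet X} {c : ℝ}
    (h : ∀ B ≤ A, ν B - ν (A \ B) ≤ c) : totalVar ν A ≤ c := by
  classical
  refine ciSup_le fun P => ?_
  set S := P.parts.filter (fun B => 0 ≤ ν B) with hS
  set N := P.parts.filter (fun B => ¬ 0 ≤ ν B) with hN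
  have hSA : S.sup id ≤ A := (Finset.sup_mono (Finset.filter_subset _ _)).trans P.sup_parts.le
  have hdec : A = S.sup id ⊔ N.sup id := by
    rw [← Finset.sup_union, hS, hN, Finset.filter_union_filter_not_eq, P.sup_parts]
  have hdis : Disjoint (S.sup id) (N.sup id) :=
    P.supIndep.disjoint_sup_sup (Finset.filter_subset _ _) (Finset.filter_subset _ _)
      (Finset.disjoint_filter_filter_not _ _ _)
  have hsd : A \ S.sup id = N.sup id := by
    conv_lhs => rw [hdec]
    rw [sup_sdiff_left_self, hdis.symm.sdiff_eq_left]
  refine le_trans (le_of_eq ?_) (h _ hSA)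
  rw [hsd, ← ba_sum_eq hν S (P.supIndep.subset (Finset.filter_subset _ _)),
    ← ba_sum_eq hν N (P.supIndep.subset (Finset.filter_subset _ _)),
    ← Finset.sum_filter_add_sum_filter_not P.parts (fun B => 0 ≤ ν B) (fun B => |ν B|),
    sub_eq_add_neg, ← Finset.sum_neg_distrib]
  congr 1
  · exact Finset.sum_congr rfl fun B hB => abs_of_nonneg (Finset.mem_filter.1 hB).2
  · exact Finset.sum_congr rfl fun B hB => abs_of_neg (not_le.1 (Finset.mem_filter.1 hB).2)

theorem abs_le_totalVar (hν : ν ∈ ba μ) (A : MSet X) : |ν A| ≤ totalVar ν A := by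
  have h1 := sub_sdiff_le_totalVar hν (le_refl A)
  have h2 := sub_sdiff_le_totalVar hν (bot_le (a := A))
  simp only [sdiff_self, sdiff_bot, ba_bot hν] at h1 h2
  exact abs_le.2 ⟨by linarith, by linarith⟩

theorem totalVar_nonneg (hν : ν ∈ ba μ) (A : MSet X) : 0 ≤ totalVar ν A :=
  (abs_nonneg _).trans (abs_le_totalVar hν A)

/-- Subsets of `A ⊔ B` are exactly the `C ⊔ D` with `C ≤ A`, `D ≤ B`, and the two-set expression
splits along them; the two suprema are therefore independent. -/
theorem totalVar_sup (hν : ν ∈ ba μ) {A B : MSet X} (hAB : Disjoint A B) :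
    totalVar ν (A ⊔ B) = totalVar ν A + totalVar ν B := by
  have key : ∀ C ≤ A, ∀ D ≤ B, ν (C ⊔ D) - ν ((A ⊔ B) \ (C ⊔ D)) =
      (ν C - ν (A \ C)) + (ν D - ν (B \ D)) := by
    intro C hC D hD
    have h1 : (A ⊔ B) \ (C ⊔ D) = A \ C ⊔ B \ D := by
      have hAD : A \ D = A := (hAB.mono_right hD).sdiff_eq_left
      have hBC : B \ C = B := (hAB.symm.mono_right hC).sdiff_eq_left
      rw [sup_sdiff, ← sdiff_sdiff, sdiff_sdiff_comm, hAD, ← sdiff_sdiff, hBC]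
    rw [h1, hν.1 _ _ (hAB.mono hC hD), hν.1 _ _ (hAB.mono sdiff_le sdiff_le)]
    ring
  apply le_antisymm
  · refine totalVar_le hν fun E hE => ?_
    have hE' : E = (E ⊓ A) ⊔ (E ⊓ B) := by rw [← inf_sup_left, inf_eq_left.2 hE]
    rw [hE', key _ inf_le_right _ inf_le_right]
    exact add_le_add (sub_sdiff_le_totalVar hν inf_le_right)
      (sub_sdiff_le_totalVar hν inf_le_right)
  · rw [← le_sub_iff_add_le]
    refine totalVar_le hν fun C hC => ?_
    rw [le_sub_iff_add_le, add_comm, ← le_sub_iff_add_le]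
    refine totalVar_le hν fun D hD => ?_
    rw [le_sub_iff_add_le, add_comm, ← key C hC D hD]
    exact sub_sdiff_le_totalVar hν (sup_le_sup hC hD)

theorem totalVar_mono (hν : ν ∈ ba μ) {A B : MSet X} (h : A ≤ B) :
    totalVar ν A ≤ totalVar ν B := by
  have := totalVar_sup hν (disjoint_sdiff_self_right (x := A) (y := B))
  rw [sup_sdiff_cancel_right h] at this
  linarith [totalVar_nonneg hν (B \ A)]

theorem totalVar_eq_zero (hν : ν ∈ ba μ) {A : MSet X} (hA : μ (A : Set X) = 0) :
    totalVar ν A = 0 := by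
  refine le_antisymm (totalVar_le hν fun B hB => ?_) (totalVar_nonneg hν A)
  have h1 : ν B = 0 := hν.2.2 B (measure_mono_null hB hA)
  have h2 : ν (A \ B) = 0 := hν.2.2 _ (measure_mono_null (sdiff_le (a := A) (b := B)) hA)
  simp [h1, h2]

theorem totalVar_mem_ba (hν : ν ∈ ba μ) : totalVar ν ∈ ba μ :=
  ⟨fun _ _ h => totalVar_sup hν h,
    ⟨totalVar ν ⊤, fun A => by
      rw [abs_of_nonneg (totalVar_nonneg hν A)]; exact totalVar_mono hν le_top⟩,
    fun _ h => totalVar_eq_zero hν h⟩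

theorem exists_outerVar_lt {S : Set X} {c : ℝ} (h : outerVar ν S < c) :
    ∃ A : MSet X, S ⊆ (A : Set X) ∧ totalVar ν A < c := by
  have : Nonempty {A : MSet X // S ⊆ (A : Set X)} := ⟨⟨⊤, Set.subset_univ _⟩⟩
  obtain ⟨A, hA⟩ := exists_lt_of_ciInf_lt h
  exact ⟨A.1, A.2, hA⟩

theorem outerVar_eq_zero (hν : ν ∈ ba μ) {S : Set X} (hS : μ S = 0) : outerVar ν S = 0 := by
  -- `S` need not be measurable, so it is covered by a measurable hull, still null.
  let A : {A : MSet X // S ⊆ (A : Set X)} :=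
    ⟨⟨toMeasurable μ S, measurableSet_toMeasurable μ S⟩, subset_toMeasurable μ S⟩
  have : Nonempty {A : MSet X // S ⊆ (A : Set X)} := ⟨A⟩
  refine le_antisymm ?_ (le_ciInf fun B => totalVar_nonneg hν B.1)
  refine (ciInf_le ⟨0, ?_⟩ A).trans (totalVar_eq_zero hν ?_).le
  · rintro _ ⟨B, rfl⟩
    exact totalVar_nonneg hν B.1
  · simpa [A] using hS

end TotalVariation

/-! ### Integrals of simple functions -/

section SimpleIntegral

variable {μ : Measure X} {ν : MSet X → ℝ}

open Classical in
/-- A set function, viewed as a family of multiplication operators on `ℝ`. -/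
def toCLM (ν : MSet X → ℝ) (s : Set X) : ℝ →L[ℝ] ℝ :=
  (if h : MeasurableSet s then ν ⟨s, h⟩ else 0) • ContinuousLinearMap.id ℝ ℝ

theorem toCLM_apply (ν : MSet X → ℝ) {s : Set X} (h : MeasurableSet s) (x : ℝ) :
    toCLM ν s x = ν ⟨s, h⟩ * x := by simp [toCLM, h]

theorem simpleIntegral_eq (ν : MSet X → ℝ) (s : SimpleFunc X ℝ) :
    simpleIntegral ν s = s.setToSimpleFunc (toCLM ν) :=
  Finset.sum_congr rfl fun y _ => by rw [toCLM_apply ν (s.measurableSet_fiber y), mul_comm]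

/-- The zero measure makes every set finite and every simple function integrable, so the side
conditions of the `setToSimpleFunc` calculus become void. -/
theorem finMeasAdditive_toCLM (hν : ν ∈ ba μ) : FinMeasAdditive (0 : Measure X) (toCLM ν) := by
  intro s t hs ht _ _ hst
  have h := hν.1 ⟨s, hs⟩ ⟨t, ht⟩ (by
    rw [disjoint_iff]; exact Subtype.ext (Set.disjoint_iff_inter_eq_empty.1 hst))
  ext
  rw [_root_.add_apply, toCLM_apply ν hs, toCLM_apply ν ht, toCLM_apply ν (hs.union ht), mul_one,
    mul_one, mul_one, ← h]
  rfl

theorem simpleIntegral_add (hν : ν ∈ ba μ) (s t : SimpleFunc X ℝ) :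
    simpleIntegral ν (s + t) = simpleIntegral ν s + simpleIntegral ν t := by
  simp only [simpleIntegral_eq]
  exact SimpleFunc.setToSimpleFunc_add _ (finMeasAdditive_toCLM hν) integrable_zero_measure
    integrable_zero_measure

theorem simpleIntegral_sub (hν : ν ∈ ba μ) (s t : SimpleFunc X ℝ) :
    simpleIntegral ν (s - t) = simpleIntegral ν s - simpleIntegral ν t := by
  simp only [simpleIntegral_eq]
  exact SimpleFunc.setToSimpleFunc_sub _ (finMeasAdditive_toCLM hν) integrable_zero_measure
    integrable_zero_measure

theorem simpleIntegral_smul (hν : ν ∈ ba μ) (c : ℝ) (s : SimpleFunc X ℝ) :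
    simpleIntegral ν (c • s) = c * simpleIntegral ν s := by
  simp only [simpleIntegral_eq]
  exact SimpleFunc.setToSimpleFunc_smul_real _ (finMeasAdditive_toCLM hν) c
    integrable_zero_measure

theorem simpleIntegral_add_left (ν ν' : MSet X → ℝ) (s : SimpleFunc X ℝ) :
    simpleIntegral (ν + ν') s = simpleIntegral ν s + simpleIntegral ν' s := by
  simp [simpleIntegral, mul_add, Finset.sum_add_distrib]

theorem simpleIntegral_smul_left (c : ℝ) (ν : MSet X → ℝ) (s : SimpleFunc X ℝ) :
    simpleIntegral (c • ν) s = c * simpleIntegral ν s := by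
  simp only [simpleIntegral, Finset.mul_sum, Pi.smul_apply, smul_eq_mul]
  exact Finset.sum_congr rfl fun _ _ => by ring

/-- The indicator function of a measurable set. -/
def simpleIndicator (A : MSet X) : SimpleFunc X ℝ :=
  SimpleFunc.piecewise A.1 A.2 (SimpleFunc.const X 1) (SimpleFunc.const X 0)

theorem simpleIndicator_apply (A : MSet X) (x : X) :
    simpleIndicator A x = (A : Set X).indicator (fun _ => 1) x := by
  classical
  simp [simpleIndicator, Set.piecewise, Set.indicator]

theorem simpleIntegral_simpleIndicator (hν : ν ∈ ba μ) (A : MSet X) :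
    simpleIntegral ν (simpleIndicator A) = ν A := by
  have h0 : toCLM ν ∅ = 0 := (finMeasAdditive_toCLM hν).map_empty_eq_zero
  rw [simpleIntegral_eq, simpleIndicator,
    SimpleFunc.setToSimpleFunc_indicator _ h0 A.2, toCLM_apply ν A.2, mul_one]

theorem simpleIntegral_const (hν : ν ∈ ba μ) (c : ℝ) :
    simpleIntegral ν (SimpleFunc.const X c) = c * ν ⊤ := by
  rw [← simpleIntegral_simpleIndicator hν ⊤, ← simpleIntegral_smul hν]
  congr 1
  ext x
  simp [simpleIndicator_apply]

/-- The level sets of `t - s` at negative values are `μ`-null, hence `ν`-null. -/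
theorem simpleIntegral_mono (hν : ν ∈ ba μ) (hpos : ∀ A, 0 ≤ ν A) {s t : SimpleFunc X ℝ}
    (h : ∀ᵐ x ∂μ, s x ≤ t x) : simpleIntegral ν s ≤ simpleIntegral ν t := by
  rw [← sub_nonneg, ← simpleIntegral_sub hν]
  refine Finset.sum_nonneg fun y _ => ?_
  rcases le_or_gt 0 y with hy | hy
  · exact mul_nonneg hy (hpos _)
  · rw [hν.2.2, mul_zero]
    refine measure_mono_null (fun x hx => ?_) (ae_iff.1 h)
    have hx' : t x - s x = y := hx
    simp only [Set.mem_ofPred_eq, not_le]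
    linarith

theorem abs_simpleIntegral_le (hν : ν ∈ ba μ) (s : SimpleFunc X ℝ) :
    |simpleIntegral ν s| ≤ simpleIntegral (totalVar ν) (s.map fun y => |y|) := by
  rw [simpleIntegral_eq (totalVar ν), SimpleFunc.map_setToSimpleFunc _
    (finMeasAdditive_toCLM (totalVar_mem_ba hν)) integrable_zero_measure abs_zero]
  refine (Finset.abs_sum_le_sum_abs _ _).trans (Finset.sum_le_sum fun y _ => ?_)
  rw [toCLM_apply _ (s.measurableSet_fiber y), abs_mul, mul_comm]
  exact mul_le_mul_of_nonneg_right (abs_le_totalVar hν _) (abs_nonneg y)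

theorem simpleIntegral_abs_le (hν : ν ∈ ba μ) {s : SimpleFunc X ℝ} {c : ℝ}
    (h : ∀ᵐ x ∂μ, |s x| ≤ c) :
    simpleIntegral (totalVar ν) (s.map fun y => |y|) ≤ c * totalVar ν ⊤ := by
  rw [← simpleIntegral_const (totalVar_mem_ba hν)]
  exact simpleIntegral_mono (totalVar_mem_ba hν) (totalVar_nonneg hν) (by simpa using h)

theorem simpleIntegral_abs_nonneg (hν : ν ∈ ba μ) (s : SimpleFunc X ℝ) :
    0 ≤ simpleIntegral (totalVar ν) (s.map fun y => |y|) :=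
  (abs_nonneg _).trans (abs_simpleIntegral_le hν s)

end SimpleIntegral
-- The integral of essentially bounded functions
section Integral

variable {μ : Measure X} {ν ν' : MSet X → ℝ}

/-- The determining sequence is arbitrary and need not be uniformly bounded. Outside a set `A` of
small variation, `u k` is close to `f`, hence to `s`; on `A` it is compared with a fixed `u N`, for
which `u N - s` is bounded. -/
theorem HasIntegral.abs_sub_simpleIntegral_le (hν : ν ∈ ba μ) {f : X → ℝ} {I : ℝ}
    (hI : HasIntegral ν f I) {s : SimpleFunc X ℝ} {ε : ℝ} (hε : 0 ≤ ε)
    (hs : ∀ᵐ x ∂μ, |f x - s x| ≤ ε) :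
    |I - simpleIntegral ν s| ≤ ε * totalVar ν ⊤ := by
  obtain ⟨u, ⟨hmeas, hcauchy⟩, hlim⟩ := hI
  have hV := totalVar_mem_ba hν
  have hV0 := totalVar_nonneg hν ⊤
  have main : ∀ δ : ℝ, 0 < δ →
      |I - simpleIntegral ν s| ≤ ε * totalVar ν ⊤ + δ * (totalVar ν ⊤ + 2) := by
    intro δ hδ
    obtain ⟨⟨a, b⟩, hab⟩ := eventually_atTop.1 (hcauchy.eventually_lt_const hδ)
    -- `N` is fixed before `A`, so the bound `C` does not depend on `k` and the variation of `A` can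
    -- be made less than `δ / (|C| + 1)`.
    set N := max a b with hN
    obtain ⟨C, hC⟩ := (u N - s).exists_forall_norm_le
    have hC' : 0 < |C| + 1 := by positivity
    have hev : ∀ᶠ k in atTop,
        |simpleIntegral ν (u k) - simpleIntegral ν s| ≤
          ε * totalVar ν ⊤ + δ * (totalVar ν ⊤ + 2) := by
      filter_upwards [(hmeas δ hδ).eventually_lt_const (div_pos hδ hC'), eventually_ge_atTop N]
        with k hk hkN
      obtain ⟨A, hA, hAδ⟩ := exists_outerVar_lt hk
      have hkN' := hab (k, N) ⟨(le_max_left a b).trans hkN, le_max_right a b⟩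
      rw [← simpleIntegral_sub hν]
      refine (abs_simpleIntegral_le hν _).trans ?_
      have hle : ∀ᵐ x ∂μ, ((u k - s).map fun y => |y|) x ≤
          (SimpleFunc.const X (ε + δ) + ((u k - u N).map fun y => |y|) +
            (|C| + 1) • simpleIndicator A) x := by
        filter_upwards [hs] with x hx
        simp only [SimpleFunc.coe_map, SimpleFunc.coe_sub, SimpleFunc.coe_add,
          SimpleFunc.coe_smul, Function.comp_apply, Pi.sub_apply, Pi.add_apply, Pi.smul_apply,
          SimpleFunc.const_apply, smul_eq_mul, simpleIndicator_apply]
        have hCx : |u N x - s x| ≤ |C| := (hC x).trans (le_abs_self C)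
        by_cases hxA : x ∈ (A : Set X)
        · rw [Set.indicator_of_mem hxA]
          linarith [abs_sub_le (u k x) (u N x) (s x)]
        · rw [Set.indicator_of_notMem hxA]
          have : |u k x - f x| ≤ δ := by
            by_contra h
            exact hxA (hA (not_le.1 h))
          linarith [abs_sub_le (u k x) (f x) (s x), abs_nonneg (u k x - u N x)]
      refine (simpleIntegral_mono hV (totalVar_nonneg hν) hle).trans ?_
      rw [simpleIntegral_add hV, simpleIntegral_add hV, simpleIntegral_const hV,
        simpleIntegral_smul hV, simpleIntegral_simpleIndicator hV]
      have h1 : (|C| + 1) * totalVar ν A ≤ δ := by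
        rw [mul_comm]; exact ((lt_div_iff₀ hC').1 hAδ).le
      have h2 : simpleIntegral (totalVar ν) ((u k - u N).map fun y => |y|) < δ := hkN'
      linarith
    exact le_of_tendsto (hlim.sub_const _).abs hev
  refine le_of_forall_pos_le_add fun η hη => ?_
  have h2 : 0 < totalVar ν ⊤ + 2 := by linarith
  have := main (η / (totalVar ν ⊤ + 2)) (div_pos hη h2)
  rwa [div_mul_cancel₀ _ h2.ne'] at this

theorem exists_simpleFunc_abs_sub_le {f : X → ℝ} (hf : Measurable f) {M : ℝ}
    (hM : ∀ᵐ x ∂μ, |f x| ≤ M) {ε : ℝ} (hε : 0 < ε) :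
    ∃ s : SimpleFunc X ℝ, ∀ᵐ x ∂μ, |f x - s x| ≤ ε := by
  -- The bound on `f` holds only almost everywhere; truncation makes it hold everywhere, so that
  -- rounding down to multiples of `ε` takes finitely many values.
  let g : X → ℝ := fun x => max (-|M|) (min |M| (f x))
  have hg : Measurable g := measurable_const.max (measurable_const.min hf)
  have hgM : ∀ x, -|M| ≤ g x ∧ g x ≤ |M| := fun x =>
    ⟨le_max_left _ _, max_le (by linarith [abs_nonneg M]) (min_le_left _ _)⟩
  have hmeas : Measurable fun x => ε * (⌊g x / ε⌋ : ℝ) :=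
    measurable_const.mul ((measurable_from_top (f := fun z : ℤ => (z : ℝ))).comp
      (hg.div_const ε).floor)
  let s : SimpleFunc X ℝ :=
    { toFun := fun x => ε * (⌊g x / ε⌋ : ℝ)
      measurableSet_fiber' := fun y => hmeas (measurableSet_singleton y)
      finite_range' := by
        refine ((Set.finite_Icc ⌊-|M| / ε⌋ ⌊|M| / ε⌋).image fun z : ℤ => ε * (z : ℝ)).subset ?_
        rintro _ ⟨x, rfl⟩
        refine ⟨⌊g x / ε⌋, ⟨Int.floor_le_floor ?_, Int.floor_le_floor ?_⟩, rfl⟩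
        · exact div_le_div_of_nonneg_right (hgM x).1 hε.le
        · exact div_le_div_of_nonneg_right (hgM x).2 hε.le }
  refine ⟨s, hM.mono fun x hx => ?_⟩
  have hx' := abs_le.1 (hx.trans (le_abs_self M))
  have hgx : g x = f x := by
    simp only [g]
    rw [min_eq_right hx'.2, max_eq_right hx'.1]
  have hsx : s x = ε * (⌊f x / ε⌋ : ℝ) := by rw [← hgx]; rfl
  have h1 : ε * (f x / ε) = f x := mul_div_cancel₀ _ hε.ne'
  have h2 := mul_le_mul_of_nonneg_left (Int.floor_le (f x / ε)) hε.le
  have h3 := mul_le_mul_of_nonneg_left (Int.lt_floor_add_one (f x / ε)).le hε.le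
  rw [hsx, abs_le]
  constructor <;> linarith

theorem faIntegrable_of_ae_bound (hν : ν ∈ ba μ) {f : X → ℝ} (hf : Measurable f) {M : ℝ}
    (hM : ∀ᵐ x ∂μ, |f x| ≤ M) : FAIntegrable ν f := by
  choose s hs using fun k : ℕ =>
    exists_simpleFunc_abs_sub_le hf hM (Nat.one_div_pos_of_nat (α := ℝ) (n := k))
  have hV0 := totalVar_nonneg hν ⊤
  have hdiff : ∀ k l : ℕ, simpleIntegral (totalVar ν) ((s k - s l).map fun y => |y|) ≤
      (1 / ((k : ℝ) + 1) + 1 / ((l : ℝ) + 1)) * totalVar ν ⊤ := by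
    intro k l
    refine simpleIntegral_abs_le hν ?_
    filter_upwards [hs k, hs l] with x hk hl
    rw [abs_sub_comm] at hk
    exact (abs_sub_le (s k x) (f x) (s l x)).trans (add_le_add hk hl)
  have hlim0 : Tendsto (fun p : ℕ × ℕ =>
      (1 / ((p.1 : ℝ) + 1) + 1 / ((p.2 : ℝ) + 1)) * totalVar ν ⊤) atTop (𝓝 0) := by
    have h := tendsto_one_div_add_atTop_nhds_zero_nat (𝕜 := ℝ)
    rw [← prod_atTop_atTop_eq]
    simpa using ((h.comp tendsto_fst).add (h.comp tendsto_snd)).mul_const (totalVar ν ⊤)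
  have hcauchy : Tendsto (fun p : ℕ × ℕ =>
      simpleIntegral (totalVar ν) ((s p.1 - s p.2).map fun y => |y|)) atTop (𝓝 0) :=
    squeeze_zero (fun p => simpleIntegral_abs_nonneg hν _) (fun p => hdiff p.1 p.2) hlim0
  have hseq : CauchySeq fun k => simpleIntegral ν (s k) := by
    rw [cauchySeq_iff_tendsto_dist_atTop_0]
    refine squeeze_zero (fun p => dist_nonneg) (fun p => ?_) hcauchy
    rw [Real.dist_eq, ← simpleIntegral_sub hν]
    exact abs_simpleIntegral_le hν _
  obtain ⟨I, hI⟩ := cauchySeq_tendsto_of_complete hseq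
  refine ⟨I, s, ⟨fun ε hε => ?_, hcauchy⟩, hI⟩
  -- Once `1 / (k + 1) < ε`, the exceptional set is null and its outer variation is exactly `0`.
  refine tendsto_const_nhds.congr' ?_
  filter_upwards [(tendsto_one_div_add_atTop_nhds_zero_nat (𝕜 := ℝ)).eventually_lt_const hε]
    with k hk
  refine (outerVar_eq_zero hν ?_).symm
  refine measure_mono_null (fun x hx => ?_) (ae_iff.1 (hs k))
  have hx' : ε < |s k x - f x| := hx
  rw [abs_sub_comm] at hx'
  exact not_le.2 (hk.trans hx')

/-- `faIntegral` is a chosen value, but the estimate holds for every value satisfying `HasIntegral`.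
-/
theorem abs_faIntegral_sub_le (hν : ν ∈ ba μ) {f : X → ℝ} (hf : Measurable f)
    {s : SimpleFunc X ℝ} {ε : ℝ} (hε : 0 ≤ ε) (hs : ∀ᵐ x ∂μ, |f x - s x| ≤ ε) :
    |faIntegral ν f - simpleIntegral ν s| ≤ ε * totalVar ν ⊤ := by
  have hint : FAIntegrable ν f := by
    obtain ⟨C, hC⟩ := s.exists_forall_norm_le
    refine faIntegrable_of_ae_bound hν hf (M := ε + C) (hs.mono fun x hx => ?_)
    have := abs_sub_abs_le_abs_sub (f x) (s x)
    have h2 : |s x| ≤ C := hC x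
    linarith
  have h : HasIntegral ν f (faIntegral ν f) := by
    rw [faIntegral, dif_pos hint]
    exact hint.choose_spec
  exact h.abs_sub_simpleIntegral_le hν hε hs

end Integral

/-! ### The dual of `L^∞` -/

section LInfty

variable {μ : Measure X} {ν ν' : MSet X → ℝ}

theorem ae_abs_le_norm (f : Lp ℝ ∞ μ) : ∀ᵐ x ∂μ, |f x| ≤ ‖f‖ := by
  filter_upwards [ae_le_eLpNormEssSup (f := f) (μ := μ)] with x hx
  rw [Lp.norm_def, ← Real.norm_eq_abs, ← toReal_enorm]
  exact ENNReal.toReal_mono (Lp.eLpNorm_ne_top f) (by rwa [eLpNorm_exponent_top])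

theorem norm_le_of_ae_abs_le {f : Lp ℝ ∞ μ} {C : ℝ} (hC : 0 ≤ C) (h : ∀ᵐ x ∂μ, |f x| ≤ C) :
    ‖f‖ ≤ C := by
  rw [Lp.norm_def, eLpNorm_exponent_top]
  exact ENNReal.toReal_le_of_le_ofReal hC (eLpNormEssSup_le_of_ae_bound h)

theorem measurable_coe_Lp (f : Lp ℝ ∞ μ) : Measurable f := (Lp.stronglyMeasurable f).measurable

theorem exists_simpleFunc_approx (f : Lp ℝ ∞ μ) {ε : ℝ} (hε : 0 < ε) :
    ∃ s : SimpleFunc X ℝ, ∀ᵐ x ∂μ, |f x - s x| ≤ ε :=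
  exists_simpleFunc_abs_sub_le (measurable_coe_Lp f) (ae_abs_le_norm f) hε

/-- The number `J` is the integral of `f` as soon as it has, up to a constant factor, the same
distance to the integrals of the simple functions near `f`. -/
theorem faIntegral_eq_of_forall_simpleFunc (hν : ν ∈ ba μ) (f : Lp ℝ ∞ μ) {J K : ℝ}
    (h : ∀ ε > 0, ∃ s : SimpleFunc X ℝ, (∀ᵐ x ∂μ, |f x - s x| ≤ ε) ∧
      |J - simpleIntegral ν s| ≤ ε * K) : faIntegral ν f = J := by
  refine eq_of_abs_sub_nonpos (le_of_forall_pos_le_add fun η hη => ?_)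
  -- With `ε` equal to `η` over this sum, the two errors `ε * totalVar ν ⊤` and `ε * K` add up to at
  -- most `η`.
  have hK : 0 < totalVar ν ⊤ + |K| + 1 := by
    linarith [totalVar_nonneg hν ⊤, abs_nonneg K]
  have hε := div_pos hη hK
  obtain ⟨s, hs, hJ⟩ := h _ hε
  have h1 := abs_faIntegral_sub_le hν (measurable_coe_Lp f) hε.le hs
  rw [abs_sub_comm] at hJ
  have h2 := abs_sub_le (faIntegral ν f) (simpleIntegral ν s) J
  have h3 := mul_le_mul_of_nonneg_left (le_abs_self K) hε.le
  have h4 := div_mul_cancel₀ η hK.ne'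
  nlinarith

theorem faIntegral_add (hν : ν ∈ ba μ) (f g : Lp ℝ ∞ μ) :
    faIntegral ν (f + g : Lp ℝ ∞ μ) = faIntegral ν f + faIntegral ν g := by
  refine faIntegral_eq_of_forall_simpleFunc hν _ (K := totalVar ν ⊤) fun ε hε => ?_
  obtain ⟨s, hs⟩ := exists_simpleFunc_approx f (half_pos hε)
  obtain ⟨t, ht⟩ := exists_simpleFunc_approx g (half_pos hε)
  refine ⟨s + t, ?_, ?_⟩
  · filter_upwards [hs, ht, Lp.coeFn_add f g] with x hx hy hxy
    rw [hxy, SimpleFunc.coe_add, Pi.add_apply, Pi.add_apply, add_sub_add_comm]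
    exact (abs_add_le _ _).trans (by linarith)
  · rw [simpleIntegral_add hν, add_sub_add_comm]
    have h1 := abs_faIntegral_sub_le hν (measurable_coe_Lp f) (half_pos hε).le hs
    have h2 := abs_faIntegral_sub_le hν (measurable_coe_Lp g) (half_pos hε).le ht
    exact (abs_add_le _ _).trans (by linarith)

theorem faIntegral_smul (hν : ν ∈ ba μ) (c : ℝ) (f : Lp ℝ ∞ μ) :
    faIntegral ν (c • f : Lp ℝ ∞ μ) = c * faIntegral ν f := by
  refine faIntegral_eq_of_forall_simpleFunc hν _ (K := totalVar ν ⊤) fun ε hε => ?_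
  have hc : 0 < |c| + 1 := by positivity
  have hδ := div_pos hε hc
  have hcδ : |c| * (ε / (|c| + 1)) ≤ ε := by
    have := div_mul_cancel₀ ε hc.ne'
    nlinarith
  obtain ⟨s, hs⟩ := exists_simpleFunc_approx f hδ
  refine ⟨c • s, ?_, ?_⟩
  · filter_upwards [hs, Lp.coeFn_smul c f] with x hx hxy
    rw [hxy, SimpleFunc.coe_smul, Pi.smul_apply, Pi.smul_apply, ← smul_sub, smul_eq_mul, abs_mul]
    exact (mul_le_mul_of_nonneg_left hx (abs_nonneg c)).trans hcδ
  · rw [simpleIntegral_smul hν, ← mul_sub, abs_mul]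
    have h1 := abs_faIntegral_sub_le hν (measurable_coe_Lp f) hδ.le hs
    refine (mul_le_mul_of_nonneg_left h1 (abs_nonneg c)).trans ?_
    rw [← mul_assoc]
    exact mul_le_mul_of_nonneg_right hcδ (totalVar_nonneg hν ⊤)

theorem faIntegral_add_left (hν : ν ∈ ba μ) (hν' : ν' ∈ ba μ) (f : Lp ℝ ∞ μ) :
    faIntegral (ν + ν') f = faIntegral ν f + faIntegral ν' f := by
  refine faIntegral_eq_of_forall_simpleFunc ((ba μ).add_mem hν hν') _
    (K := totalVar ν ⊤ + totalVar ν' ⊤) fun ε hε => ?_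
  obtain ⟨s, hs⟩ := exists_simpleFunc_approx f hε
  refine ⟨s, hs, ?_⟩
  rw [simpleIntegral_add_left, add_sub_add_comm, mul_add]
  exact (abs_add_le _ _).trans (add_le_add
    (abs_faIntegral_sub_le hν (measurable_coe_Lp f) hε.le hs)
    (abs_faIntegral_sub_le hν' (measurable_coe_Lp f) hε.le hs))

theorem faIntegral_smul_left (hν : ν ∈ ba μ) (c : ℝ) (f : Lp ℝ ∞ μ) :
    faIntegral (c • ν) f = c * faIntegral ν f := by
  refine faIntegral_eq_of_forall_simpleFunc ((ba μ).smul_mem c hν) _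
    (K := |c| * totalVar ν ⊤) fun ε hε => ?_
  obtain ⟨s, hs⟩ := exists_simpleFunc_approx f hε
  refine ⟨s, hs, ?_⟩
  rw [simpleIntegral_smul_left, ← mul_sub, abs_mul, mul_left_comm]
  exact mul_le_mul_of_nonneg_left
    (abs_faIntegral_sub_le hν (measurable_coe_Lp f) hε.le hs) (abs_nonneg c)

theorem abs_faIntegral_le (hν : ν ∈ ba μ) (f : Lp ℝ ∞ μ) :
    |faIntegral ν f| ≤ totalVar ν ⊤ * ‖f‖ := by
  have h := abs_faIntegral_sub_le hν (measurable_coe_Lp f) (s := SimpleFunc.const X 0)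
    (norm_nonneg f) (by simpa using ae_abs_le_norm f)
  rwa [simpleIntegral_const hν, zero_mul, sub_zero, mul_comm] at h

/-- The class in `L^∞` of a simple function. -/
def simpleLp (μ : Measure X) : SimpleFunc X ℝ →ₗ[ℝ] Lp ℝ ∞ μ where
  toFun s := (s.memLp_top μ).toLp s
  map_add' s t := MemLp.toLp_add (s.memLp_top μ) (t.memLp_top μ)
  map_smul' c s := MemLp.toLp_const_smul c (s.memLp_top μ)

theorem coeFn_simpleLp (μ : Measure X) (s : SimpleFunc X ℝ) : simpleLp μ s =ᵐ[μ] s :=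
  (s.memLp_top μ).coeFn_toLp

theorem faIntegral_simpleLp (hν : ν ∈ ba μ) (s : SimpleFunc X ℝ) :
    faIntegral ν (simpleLp μ s) = simpleIntegral ν s := by
  refine faIntegral_eq_of_forall_simpleFunc hν _ (K := 0) fun ε hε => ⟨s, ?_, by simp⟩
  filter_upwards [coeFn_simpleLp μ s] with x hx
  rw [hx, sub_self, abs_zero]
  exact hε.le

theorem norm_simpleLp_le {s : SimpleFunc X ℝ} {C : ℝ} (hC : 0 ≤ C) (h : ∀ x, |s x| ≤ C) :
    ‖simpleLp μ s‖ ≤ C :=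
  norm_le_of_ae_abs_le hC ((coeFn_simpleLp μ s).mono fun x hx => by rw [hx]; exact h x)

/-- Integration against a finitely additive measure, as a functional on `L^∞`. -/
def integralCLM (ν : ba μ) : StrongDual ℝ (Lp ℝ ∞ μ) :=
  LinearMap.mkContinuous
    { toFun := fun f => faIntegral (ν : MSet X → ℝ) f
      map_add' := faIntegral_add ν.2
      map_smul' := faIntegral_smul ν.2 } (totalVar (ν : MSet X → ℝ) ⊤)
    fun f => abs_faIntegral_le ν.2 f

theorem integralCLM_apply (ν : ba μ) (f : Lp ℝ ∞ μ) :
    integralCLM ν f = faIntegral (ν : MSet X → ℝ) f := rfl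

theorem integralCLM_simpleIndicator (ν : ba μ) (A : MSet X) :
    integralCLM ν (simpleLp μ (simpleIndicator A)) = (ν : MSet X → ℝ) A := by
  rw [integralCLM_apply, faIntegral_simpleLp ν.2, simpleIntegral_simpleIndicator ν.2]

theorem simpleIndicator_sup {A B : MSet X} (h : Disjoint A B) :
    simpleIndicator (A ⊔ B) = simpleIndicator A + simpleIndicator B := by
  have h' : Disjoint (A : Set X) B := Set.disjoint_iff_inter_eq_empty.2
    (congrArg Subtype.val (disjoint_iff.1 h))
  ext x
  simp only [SimpleFunc.coe_add, Pi.add_apply, simpleIndicator_apply]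
  exact congrFun (Set.indicator_union_of_disjoint h' _) x

/-- The values of `φ` on indicators define `ν`. Linearity gives agreement on simple functions, and
continuity carries it to their uniform limits. -/
theorem exists_integralCLM_eq (φ : StrongDual ℝ (Lp ℝ ∞ μ)) : ∃ ν : ba μ, integralCLM ν = φ := by
  let ν : MSet X → ℝ := fun A => φ (simpleLp μ (simpleIndicator A))
  have hν : ν ∈ ba μ := by
    refine ⟨fun A B h => ?_, ⟨‖φ‖, fun A => ?_⟩, fun A hA => ?_⟩
    · simp only [ν, simpleIndicator_sup h, map_add]
    · refine (φ.le_opNorm _).trans (mul_le_of_le_one_right (norm_nonneg φ) ?_)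
      refine norm_simpleLp_le zero_le_one fun x => ?_
      rw [simpleIndicator_apply]
      by_cases hx : x ∈ (A : Set X) <;> simp [hx]
    · have : simpleLp μ (simpleIndicator A) = 0 := by
        refine Lp.eq_zero_iff_ae_eq_zero.2 ((coeFn_simpleLp μ _).trans ?_)
        filter_upwards [measure_eq_zero_iff_ae_notMem.1 hA] with x hx
        rw [simpleIndicator_apply, Set.indicator_of_notMem hx, Pi.zero_apply]
      simp only [ν, this, map_zero]
  have hsimple : ∀ s : SimpleFunc X ℝ, simpleIntegral ν s = φ (simpleLp μ s) := by
    intro s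
    induction s using SimpleFunc.induction with
    | const c hs =>
      rename_i A
      have : SimpleFunc.piecewise A hs (SimpleFunc.const X c) (SimpleFunc.const X 0) =
          c • simpleIndicator ⟨A, hs⟩ := by
        ext x
        by_cases hx : x ∈ A <;> simp [hx, simpleIndicator_apply]
      rw [this, simpleIntegral_smul hν, simpleIntegral_simpleIndicator hν, map_smul, map_smul,
        smul_eq_mul]
    | add _ hs ht => rw [simpleIntegral_add hν, hs, ht, map_add, map_add]
  refine ⟨⟨ν, hν⟩, ContinuousLinearMap.ext fun f => ?_⟩
  refine faIntegral_eq_of_forall_simpleFunc hν f (K := ‖φ‖) fun ε hε => ?_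
  obtain ⟨s, hs⟩ := exists_simpleFunc_approx f hε
  refine ⟨s, hs, ?_⟩
  rw [hsimple, ← map_sub, mul_comm]
  refine (φ.le_opNorm _).trans (mul_le_mul_of_nonneg_left ?_ (norm_nonneg φ))
  refine norm_le_of_ae_abs_le hε.le ?_
  filter_upwards [hs, coeFn_simpleLp μ s, Lp.coeFn_sub f (simpleLp μ s)] with x hx h1 h2
  rwa [h2, Pi.sub_apply, h1]

/-- An approximate Hahn decomposition `B`, `⊤ \ B` supplies the sign function; for finitely additive
measures an exact one need not exist. -/
theorem exists_norm_le_one_lt_integralCLM (ν : ba μ) {c : ℝ}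
    (hc : c < totalVar (ν : MSet X → ℝ) ⊤) :
    ∃ f : Lp ℝ ∞ μ, ‖f‖ ≤ 1 ∧ c < integralCLM ν f := by
  obtain ⟨B, hB⟩ : ∃ B : MSet X, c < (ν : MSet X → ℝ) B - (ν : MSet X → ℝ) (⊤ \ B) := by
    by_contra! h
    exact hc.not_ge (totalVar_le ν.2 fun B _ => h B)
  refine ⟨simpleLp μ (simpleIndicator B - simpleIndicator (⊤ \ B)), ?_, ?_⟩
  · refine norm_simpleLp_le zero_le_one fun x => ?_
    have hmem : x ∈ ((⊤ \ B : MSet X) : Set X) ↔ x ∉ (B : Set X) := by simp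
    rw [SimpleFunc.coe_sub, Pi.sub_apply, simpleIndicator_apply, simpleIndicator_apply]
    by_cases hx : x ∈ (B : Set X)
    · rw [Set.indicator_of_mem hx, Set.indicator_of_notMem (fun h => hmem.1 h hx)]; simp
    · rw [Set.indicator_of_notMem hx, Set.indicator_of_mem (hmem.2 hx)]; simp
  · rwa [map_sub, map_sub, integralCLM_simpleIndicator, integralCLM_simpleIndicator]

end LInfty

/-! ### Finite powers of `L^∞` -/

section Product

variable {μ : Measure X} {ι : Type*} [Fintype ι]

/-- The functional `f ↦ ∑ ∫ f k d(ν k)` on a finite power of `L^∞`, linearly in `ν`. -/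
def sumIntegral (μ : Measure X) (ι : Type*) [Fintype ι] :
    (ι → ba μ) →ₗ[ℝ] StrongDual ℝ (ι → Lp ℝ ∞ μ) where
  toFun ν := ∑ k, (integralCLM (ν k)).comp (ContinuousLinearMap.proj k)
  map_add' ν ν' := by
    ext f
    simp [integralCLM_apply, faIntegral_add_left (ν _).2 (ν' _).2, Finset.sum_add_distrib]
  map_smul' c ν := by
    ext f
    simp [integralCLM_apply, faIntegral_smul_left (ν _).2, Finset.mul_sum]

theorem sumIntegral_apply (ν : ι → ba μ) (f : ι → Lp ℝ ∞ μ) :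
    sumIntegral μ ι ν f = ∑ k, integralCLM (ν k) (f k) := by
  simp [sumIntegral]

theorem sumIntegral_single [DecidableEq ι] (ν : ι → ba μ) (k : ι) (f : Lp ℝ ∞ μ) :
    sumIntegral μ ι ν (Pi.single k f) = integralCLM (ν k) f := by
  rw [sumIntegral_apply, Finset.sum_eq_single k]
  · rw [Pi.single_eq_same]
  · intro j _ hj
    rw [Pi.single_eq_of_ne hj, map_zero]
  · simp

/-- Functions supported in one coordinate isolate each `ν k`: indicators there recover it, and
restricting `φ` to them reduces surjectivity to the scalar case. -/
theorem sumIntegral_bijective : Function.Bijective (sumIntegral μ ι) := by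
  classical
  constructor
  · intro ν ν' h
    funext k
    ext A
    rw [← integralCLM_simpleIndicator (ν k) A, ← integralCLM_simpleIndicator (ν' k) A,
      ← sumIntegral_single, ← sumIntegral_single, h]
  · intro φ
    choose ν hν using fun k : ι =>
      exists_integralCLM_eq (φ.comp (ContinuousLinearMap.single ℝ (fun _ : ι => Lp ℝ ∞ μ) k))
    refine ⟨ν, ContinuousLinearMap.ext fun f => ?_⟩
    rw [sumIntegral_apply]
    conv_rhs => rw [← Finset.univ_sum_single f, map_sum]
    exact Finset.sum_congr rfl fun k _ => by rw [hν k]; rfl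

theorem norm_sumIntegral (ν : ι → ba μ) :
    ‖sumIntegral μ ι ν‖ = ∑ k, totalVar (ν k : MSet X → ℝ) ⊤ := by
  apply le_antisymm
  · refine ContinuousLinearMap.opNorm_le_bound _
      (Finset.sum_nonneg fun k _ => totalVar_nonneg (ν k).2 ⊤) fun f => ?_
    rw [sumIntegral_apply, Finset.sum_mul]
    refine (norm_sum_le _ _).trans (Finset.sum_le_sum fun k _ => ?_)
    exact (abs_faIntegral_le (ν k).2 (f k)).trans
      (mul_le_mul_of_nonneg_left (norm_le_pi_norm f k) (totalVar_nonneg (ν k).2 ⊤))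
  · refine le_of_forall_pos_le_add fun η hη => ?_
    -- Each coordinate may lose `η / (card ι + 1)`, for a total of at most `η`; the `+ 1` covers an
    -- empty index type.
    have hcard : (0 : ℝ) < Fintype.card ι + 1 := by positivity
    choose f hf hlt using fun k : ι => exists_norm_le_one_lt_integralCLM (ν k)
      (sub_lt_self (totalVar (ν k : MSet X → ℝ) ⊤) (div_pos hη hcard))
    have hf1 : ‖f‖ ≤ 1 := (pi_norm_le_iff_of_nonneg zero_le_one).2 hf
    have h1 : sumIntegral μ ι ν f ≤ ‖sumIntegral μ ι ν‖ :=
      (le_abs_self _).trans (((sumIntegral μ ι ν).le_opNorm f).trans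
        (mul_le_of_le_one_right (norm_nonneg _) hf1))
    have h2 := Finset.sum_le_sum fun k (_ : k ∈ Finset.univ) => (hlt k).le
    rw [← sumIntegral_apply, Finset.sum_sub_distrib, Finset.sum_const, Finset.card_univ,
      nsmul_eq_mul] at h2
    have h3 : (Fintype.card ι : ℝ) * (η / (Fintype.card ι + 1)) ≤ η := by
      rw [← mul_div_assoc, div_le_iff₀ hcard]
      nlinarith
    linarith

end Product

end

end FinAdd

theorem mainTheorem7 (n : ℕ) (Ω : Set (EuclideanSpace ℝ (Fin n))) :
    ∃ Φ : (Fin n → FinAdd.ba (FinAdd.lebesgueOn Ω)) ≃ₗ[ℝ]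
        StrongDual ℝ (Fin n → Lp ℝ ∞ (FinAdd.lebesgueOn Ω)),
      (∀ (ν : Fin n → FinAdd.ba (FinAdd.lebesgueOn Ω))
          (f : Fin n → Lp ℝ ∞ (FinAdd.lebesgueOn Ω)),
        (∀ k, FinAdd.FAIntegrable (ν k : FinAdd.MSet Ω → ℝ) (f k : Ω → ℝ)) ∧
        Φ ν f = ∑ k, FinAdd.faIntegral (ν k : FinAdd.MSet Ω → ℝ) (f k : Ω → ℝ)) ∧
      (∀ ν : Fin n → FinAdd.ba (FinAdd.lebesgueOn Ω),
        ‖Φ ν‖ = ∑ k, FinAdd.totalVar (ν k : FinAdd.MSet Ω → ℝ) ⊤) := by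
  refine ⟨LinearEquiv.ofBijective (FinAdd.sumIntegral (FinAdd.lebesgueOn Ω) (Fin n))
    FinAdd.sumIntegral_bijective, fun ν f => ⟨fun k => ?_, ?_⟩, FinAdd.norm_sumIntegral⟩
  · exact FinAdd.faIntegrable_of_ae_bound (ν k).2 (FinAdd.measurable_coe_Lp (f k))
      (FinAdd.ae_abs_le_norm (f k))
  · exact FinAdd.sumIntegral_apply ν f
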